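/- For a finite set $X$, let $H$ denote the graph whose vertex set is the power set $\mathcal{P}X$, in which two distinct subsets $x,y\subset X$ are joined by an edge if and only if $x\cap y=\emptyset$. For $\mathcal{A}\subset\mathcal{P}X$ let $H[\mathcal{A}]$ be the subgraph of $H$ induced on $\mathcal{A}$. For every real $c>0$ there exists a real $b>0$, depending only on $c$, such that the following holds. For every integer $n\ge 4$, every $n$-element set $X$ and every $\mathcal{A}\subset\mathcal{P}X$ with $|\mathcal{A}|\ge c\,2^{n/2}$, the graph $H[\mathcal{A}]$ can be made bipartite by removing at most $$\frac{(\log_2\log_2 n)^b}{\log_2 n}\,|\mathcal{A}|^2$$ edges. -/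

import Mathlib

/-- The (generalised) Kneser graph on the power set of a finite set `X`: its vertices are all
subsets of `X`, and two distinct subsets are adjacent when they are disjoint. (Distinctness only
rules out a loop at the empty set.) -/
def kneserGraph (X : Type*) : SimpleGraph (Finset X) where
  Adj x y := x ≠ y ∧ Disjoint x y
  symm := ⟨fun _ _ h => ⟨h.1.symm, h.2.symm⟩⟩
  loopless := ⟨fun _ h => h.1 rfl⟩

/-- The graph `G` can be made bipartite by removing at most `t` of its edges. -/
def CanBeMadeBipartiteByRemoving {V : Type*} (G : SimpleGraph V) (t : ℝ) : Prop :=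
  ∃ D : Finset (Sym2 V), (D : Set (Sym2 V)) ⊆ G.edgeSet ∧ (D.card : ℝ) ≤ t ∧
    (G.deleteEdges (D : Set (Sym2 V))).IsBipartite

/-! Around a short odd closed walk, sets of size nearly n/2 cannot be consecutively almost disjoint:
sets two steps apart would almost coincide, so some set would be almost disjoint from itself
(`card_le_of_odd_closed_chain`). Members of A may be small, so the proof manufactures large sets.

Let N = |A| and sample q vertices. For at least half of the samples, all but 2N²/q edges have both
ends adjacent to sample points (`card_good_samples`). Relate two sample points when at least N²/q³
oriented edges bridge their neighbourhoods. If this relation is 2-colourable, giving each vertex the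
colour of an adjacent sample point leaves at most 3N²/q monochromatic edges. Otherwise it has an odd
closed walk of length at most q, and by pigeonhole over relations one walk serves a proportion
2^-(q²+1) of the samples. Inserting bridges gives many copies of the walk with each step subdivided
into three disjointness relations, at a density depending on q alone.

Such a pattern can be blown up (`exists_large_disjoint_pattern`): a union of t sets inherits
disjointness from its members, convexity keeps the density positive, and t-tuples with union of size
at most s number at most 2^n 2^(st), too few when N is about 2^(n/2), t = 64q and s = n/2 - n/(16q).
The resulting large sets contradict the first paragraph. All this needs only q^(7q) ≤ n, so q can be
of order log n / log log n. -/

open Finset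

/-! ### Odd closed walks and two-colourings -/

/-- A shortest odd closed walk of a relation on `q` points has length at most `q`. -/
theorem exists_short_odd_closed_walk {q : ℕ} (R : Fin q → Fin q → Prop)
    (h : ∃ (m : ℕ) (w : ℕ → Fin q), Odd m ∧ w m = w 0 ∧ ∀ i < m, R (w i) (w (i + 1))) :
    ∃ (m : ℕ) (w : ℕ → Fin q), m ≤ q ∧ Odd m ∧ w m = w 0 ∧ ∀ i < m, R (w i) (w (i + 1)) := by
  classical
  obtain ⟨w, hodd, hclosed, hR⟩ := Nat.find_spec h
  have hmin := fun m' (hm' : m' < Nat.find h) => Nat.find_min h hm'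
  set m := Nat.find h
  refine ⟨m, w, ?_, hodd, hclosed, hR⟩
  by_contra! hlt
  obtain ⟨i, hi, j, hj, hij, hw⟩ : ∃ i < m, ∃ j < m, i < j ∧ w i = w j := by
    obtain ⟨a, b, hab, heq⟩ := Fintype.exists_ne_map_eq_of_card_lt
      (fun i : Fin m => w i) (by simpa using hlt)
    rcases lt_or_gt_of_ne (Fin.val_ne_of_ne hab) with hl | hl
    · exact ⟨a, a.2, b, b.2, hl, heq⟩
    · exact ⟨b, b.2, a, a.2, hl, heq.symm⟩
  -- The repeated vertex splits the walk into two shorter closed walks of total length `m`; the odd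
  -- one contradicts minimality.
  rcases Nat.even_or_odd (j - i) with he | ho
  · refine hmin (m - (j - i)) (by omega)
      ⟨fun k => if k ≤ i then w k else w (k + (j - i)), ?_, ?_, ?_⟩
    · exact Nat.Odd.sub_even (by omega) hodd he
    · have h1 : ¬ m - (j - i) ≤ i := by omega
      have h2 : m - (j - i) + (j - i) = m := by omega
      simp only [h1, if_false, h2, hclosed, Nat.zero_le, if_true]
    · intro k hk
      rcases lt_trichotomy k i with hki | hki | hki
      · have h1 : k ≤ i := by omega
        have h2 : k + 1 ≤ i := by omega
        simpa only [h1, h2, if_true] using hR k (by omega)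
      · have h1 : k ≤ i := by omega
        have h2 : ¬ k + 1 ≤ i := by omega
        have h3 : k + 1 + (j - i) = j + 1 := by omega
        simp only [h1, h2, if_true, if_false, h3]
        rw [hki, hw]
        exact hR j hj
      · have h1 : ¬ k ≤ i := by omega
        have h2 : ¬ k + 1 ≤ i := by omega
        have h3 : k + 1 + (j - i) = k + (j - i) + 1 := by omega
        simp only [h1, h2, if_false, h3]
        exact hR _ (by omega)
  · refine hmin (j - i) (by omega) ⟨fun k => w (i + k), ho, ?_, ?_⟩
    · have h1 : i + (j - i) = j := by omega
      simp only [h1, add_zero, hw]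
    · intro k hk
      exact hR (i + k) (by omega)

/-- A symmetric relation on `q` points can be properly two-coloured, or it has an odd closed walk
of length at most `q`. -/
theorem two_coloring_or_odd_closed_walk {q : ℕ} (R : Fin q → Fin q → Prop)
    (hsymm : ∀ j k, R j k → R k j) :
    (∃ f : Fin q → Bool, ∀ j k, R j k → f j ≠ f k) ∨
    ∃ (m : ℕ) (w : ℕ → Fin q), m ≤ q ∧ Odd m ∧ w m = w 0 ∧ ∀ i < m, R (w i) (w (i + 1)) := by
  by_cases hloop : ∃ j, R j j
  · obtain ⟨j, hj⟩ := hloop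
    exact Or.inr (exists_short_odd_closed_walk R
      ⟨1, fun _ => j, odd_one, rfl, fun _ _ => hj⟩)
  push Not at hloop
  let G : SimpleGraph (Fin q) :=
    { Adj := R
      symm := ⟨fun j k h => hsymm j k h⟩
      loopless := ⟨fun j h => hloop j h⟩ }
  by_cases hG : G.Colorable 2
  · left
    obtain ⟨C⟩ := hG
    refine ⟨fun j => decide (C j = 0), fun j k hjk heq => ?_⟩
    have hne : C j ≠ C k := C.valid (v := j) (w := k) hjk
    have h1 := decide_eq_decide.1 heq
    omega
  · right
    rw [SimpleGraph.two_colorable_iff_forall_loop_even] at hG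
    push Not at hG
    obtain ⟨u, p, hp⟩ := hG
    refine exists_short_odd_closed_walk R ⟨p.length, p.getVert, ?_, ?_, ?_⟩
    · simpa using hp
    · simp
    · intro i hi
      exact p.adj_getVert_succ hi

/-! ### Blowing up coordinates into unions -/

/-- Few `t`-tuples of sets have a small union. -/
theorem card_tuples_small_union {X V : Type*} [Fintype X] [DecidableEq X] [Fintype V]
    (φ : V → Finset X) (hφ : Function.Injective φ) (s t : ℕ) :
    #{T : Fin t → V | #(univ.biUnion fun j => φ (T j)) ≤ s} ≤
      2 ^ Fintype.card X * (2 ^ s) ^ t := by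
  classical
  have hsub : ({T : Fin t → V | #(univ.biUnion fun j => φ (T j)) ≤ s} : Finset _) ⊆
      ({W : Finset X | #W ≤ s} : Finset _).biUnion
        fun W => Fintype.piFinset fun _ => ({v : V | φ v ⊆ W} : Finset V) := by
    intro T hT
    simp only [mem_filter, mem_univ, true_and] at hT
    simp only [mem_biUnion, mem_filter, mem_univ, true_and, Fintype.mem_piFinset]
    exact ⟨_, hT, fun j => subset_biUnion_of_mem (fun j => φ (T j)) (mem_univ j)⟩
  refine (card_le_card hsub).trans (card_biUnion_le.trans ?_)
  calc ∑ W ∈ ({W : Finset X | #W ≤ s} : Finset _),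
        #(Fintype.piFinset fun _ : Fin t => ({v : V | φ v ⊆ W} : Finset V))
      ≤ ∑ _W ∈ ({W : Finset X | #W ≤ s} : Finset _), (2 ^ s) ^ t := by
        refine sum_le_sum fun W hW => ?_
        rw [Fintype.card_piFinset_const]
        refine Nat.pow_le_pow_left ?_ t
        have h1 : #({v : V | φ v ⊆ W} : Finset V) ≤ #W.powerset := by
          refine card_le_card_of_injOn φ ?_ hφ.injOn
          intro v hv
          simpa using hv
        rw [card_powerset] at h1
        exact h1.trans (Nat.pow_le_pow_right (by norm_num) (by simpa using hW))
    _ ≤ 2 ^ Fintype.card X * (2 ^ s) ^ t := by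
        rw [sum_const, smul_eq_mul]
        refine Nat.mul_le_mul_right _ ?_
        exact (card_filter_le _ _).trans (by simp)

/-- Convexity: the density of a set of functions after replacing one coordinate by `t`
independent copies is at least the `t`-th power of the original density. -/
theorem pow_density_le_sum_tuples {ι V : Type*} [Fintype ι] [DecidableEq ι] [Fintype V] [DecidableEq V]
    (P : Finset (ι → V)) (i : ι) (t : ℕ) (p : ℝ) (hp : 0 ≤ p)
    (hP : p * (Fintype.card V : ℝ) ^ Fintype.card ι ≤ #P) :
    (p * Fintype.card V) ^ t * (Fintype.card V : ℝ) ^ Fintype.card ι ≤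
      ∑ T : Fin t → V, (#{y : ι → V | ∀ j, Function.update y i (T j) ∈ P} : ℝ) := by
  classical
  set N := Fintype.card V with hN
  have hcard : #(univ : Finset (ι → V)) = N ^ Fintype.card ι := by simp [hN]
  let d : (ι → V) → ℕ := fun y => #{a : V | Function.update y i a ∈ P}
  have hd : ∑ y, d y = N * #P := by
    -- Exchanging `y i` with `a` turns the condition on the updated function into one on the
    -- function itself.
    let e : (ι → V) × V → (ι → V) × V := fun z => (Function.update z.1 i z.2, z.1 i)
    have he : Function.Involutive e := by
      rintro ⟨y, a⟩
      simp [e]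
    have h1 : ∑ y, d y = ∑ z : (ι → V) × V, if (e z).1 ∈ P then 1 else 0 := by
      rw [Fintype.sum_prod_type]
      refine sum_congr rfl fun y _ => ?_
      simp only [d, e, card_filter]
    have h2 : ∑ z : (ι → V) × V, (if (e z).1 ∈ P then 1 else 0) =
        ∑ z : (ι → V) × V, if z.1 ∈ P then 1 else 0 :=
      Equiv.sum_comp (he.toPerm e) (fun z : (ι → V) × V => if z.1 ∈ P then 1 else 0)
    rw [h1, h2, Fintype.sum_prod_type_right]
    trans ∑ _a : V, #P
    · exact sum_congr rfl fun a _ => by simp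
    · simp [hN]
  -- For fixed `y` the entries of `T` are chosen independently, `d y` ways each; Jensen then applies
  -- to the power sum.
  have hswap : ∑ T : Fin t → V, (#{y : ι → V | ∀ j, Function.update y i (T j) ∈ P} : ℝ) =
      ∑ y, (d y : ℝ) ^ t := by
    have h1 : ∑ T : Fin t → V, #{y : ι → V | ∀ j, Function.update y i (T j) ∈ P} =
        ∑ y, d y ^ t := by
      simp only [card_filter]
      rw [sum_comm]
      refine sum_congr rfl fun y _ => ?_
      rw [← card_filter, ← Fintype.card_piFinset_const]
      congr 1
      ext T
      simp [Fintype.mem_piFinset]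
    exact_mod_cast h1
  rw [hswap]
  rcases Nat.eq_zero_or_pos t with ht | ht
  · subst ht
    simp only [pow_zero, one_mul, sum_const, hcard, nsmul_eq_mul, mul_one, Nat.cast_pow, le_refl]
  rcases Nat.eq_zero_or_pos N with h0 | hpos
  · rw [h0, Nat.cast_zero, mul_zero, zero_pow ht.ne', zero_mul]
    exact sum_nonneg fun y _ => by positivity
  have hNpos : (0 : ℝ) < N := by exact_mod_cast hpos
  obtain ⟨k, rfl⟩ : ∃ k, t = k + 1 := ⟨t - 1, by omega⟩
  have hJ := pow_sum_div_card_le_sum_pow (s := (univ : Finset (ι → V))) (f := fun y => (d y : ℝ))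
    (fun _ _ => by positivity) k
  refine le_trans ?_ hJ
  rw [hcard]
  have hsum : ∑ y, (d y : ℝ) = N * #P := by exact_mod_cast hd
  rw [hsum]
  push_cast
  set M : ℝ := (N : ℝ) ^ Fintype.card ι with hM
  have hMpos : 0 < M := by positivity
  rw [le_div_iff₀ (by positivity)]
  calc (p * N) ^ (k + 1) * M * M ^ k = (N * (p * M)) ^ (k + 1) := by ring
    _ ≤ (N * #P) ^ (k + 1) := by gcongr

/-- One blow-up step: coordinate `i` is replaced by a union of `t` sets, of more than `s`
elements. -/
theorem exists_blowup_coordinate {ι X V : Type*} [Fintype ι] [DecidableEq ι] [Fintype X]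
    [DecidableEq X] [Fintype V] [DecidableEq V] [Nonempty V]
    (φ : V → Finset X) (hφ : Function.Injective φ) (s t : ℕ)
    (P : Finset (ι → V)) (i : ι) (p : ℝ) (hp : 0 < p)
    (hP : p * (Fintype.card V : ℝ) ^ Fintype.card ι ≤ #P)
    (hbad : 2 * (2 ^ Fintype.card X * (2 ^ s) ^ t : ℝ) ≤ (p * Fintype.card V) ^ t) :
    ∃ T : Fin t → V, s < #(univ.biUnion fun j => φ (T j)) ∧
      p ^ t / 2 * (Fintype.card V : ℝ) ^ Fintype.card ι ≤
        #{y : ι → V | ∀ j, Function.update y i (T j) ∈ P} := by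
  classical
  by_contra! hcon
  have hsum := pow_density_le_sum_tuples P i t p hp.le hP
  set N := Fintype.card V with hN
  have hNpos : (0 : ℝ) < N := by
    have : 0 < N := Fintype.card_pos
    exact_mod_cast this
  set M : ℝ := (N : ℝ) ^ Fintype.card ι with hM
  have hMpos : 0 < M := by positivity
  let B : Finset (Fin t → V) := {T : Fin t → V | #(univ.biUnion fun j => φ (T j)) ≤ s}
  have hB : (#B : ℝ) ≤ 2 ^ Fintype.card X * (2 ^ s) ^ t := by
    exact_mod_cast card_tuples_small_union φ hφ s t
  let F : (Fin t → V) → ℝ := fun T => (#{y : ι → V | ∀ j, Function.update y i (T j) ∈ P} : ℝ)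
  have hFM : ∀ T, F T ≤ M := by
    intro T
    have h1 : #{y : ι → V | ∀ j, Function.update y i (T j) ∈ P} ≤ N ^ Fintype.card ι :=
      (card_filter_le _ _).trans (by simp [hN])
    simp only [F, hM]
    exact_mod_cast h1
  have hle : ∀ T, F T ≤ p ^ t / 2 * M + if T ∈ B then M else 0 := by
    intro T
    by_cases hT : T ∈ B
    · rw [if_pos hT]
      have := hFM T
      have h2 : 0 ≤ p ^ t / 2 * M := by positivity
      linarith
    · rw [if_neg hT]
      have h3 : s < #(univ.biUnion fun j => φ (T j)) := by simpa [B] using hT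
      have := hcon T h3
      simp only [F]
      linarith
  -- A tuple outside `B` makes the comparison of sums strict; were there none, `hbad` would give N^t
  -- ≤ N^t / 2.
  obtain ⟨T₀, hT₀⟩ : ∃ T₀ : Fin t → V, T₀ ∉ B := by
    by_contra! hall
    have h1 : B = univ := eq_univ_of_forall hall
    rw [h1] at hB
    have h2 : (#(univ : Finset (Fin t → V)) : ℝ) = (N : ℝ) ^ t := by simp [hN]
    rw [h2] at hB
    have hp1 : p ≤ 1 := by
      have h3 : (#P : ℝ) ≤ M := by
        have : #P ≤ N ^ Fintype.card ι := (card_le_univ _).trans (by simp [hN])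
        rw [hM]
        exact_mod_cast this
      have : p * M ≤ 1 * M := by linarith
      exact le_of_mul_le_mul_right this hMpos
    have h4 : (p * N) ^ t ≤ (N : ℝ) ^ t := by
      refine pow_le_pow_left₀ (by positivity) ?_ t
      nlinarith
    have h5 : (0 : ℝ) < (N : ℝ) ^ t := by positivity
    linarith
  have hlt : ∑ T, F T < ∑ T, (p ^ t / 2 * M + if T ∈ B then M else 0) := by
    refine sum_lt_sum (fun T _ => hle T) ⟨T₀, mem_univ _, ?_⟩
    rw [if_neg hT₀, add_zero]
    exact hcon T₀ (by simpa [B] using hT₀)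
  have heq : ∑ T : Fin t → V, (p ^ t / 2 * M + if T ∈ B then M else 0) =
      (N : ℝ) ^ t * (p ^ t / 2 * M) + #B * M := by
    rw [sum_add_distrib, sum_ite_mem]
    simp [hN]
  rw [heq] at hlt
  have h6 : (#B : ℝ) * M ≤ (p * N) ^ t / 2 * M := by
    gcongr
    linarith
  have h7 : (N : ℝ) ^ t * (p ^ t / 2 * M) = (p * N) ^ t / 2 * M := by rw [mul_pow]; ring
  have h8 : (p * N) ^ t * M ≤ ∑ T, F T := hsum
  linarith

/-- Blow-up of a dense pattern `K` of pairwise disjointness: every coordinate can be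
replaced by a single set with more than `s` elements. -/
theorem exists_large_disjoint_pattern {ι X V : Type*} [Fintype ι] [Fintype X]
    [Fintype V] [Nonempty V]
    (φ : V → Finset X) (hφ : Function.Injective φ) (s t : ℕ)
    (K : ι → ι → Prop) (hK : ∀ a, ¬ K a a) (p : ℝ) (hp : 0 < p) (hp2 : p ≤ 1 / 2)
    (hbad : 2 * (2 ^ Fintype.card X * (2 ^ s) ^ t : ℝ) ≤
      (p ^ ((t + 1) ^ Fintype.card ι) * Fintype.card V) ^ t)
    (P : Finset (ι → V)) (hPK : ∀ y ∈ P, ∀ a b, K a b → Disjoint (φ (y a)) (φ (y b)))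
    (hP : p * (Fintype.card V : ℝ) ^ Fintype.card ι ≤ #P) :
    ∃ U : ι → Finset X, (∀ a, s < #(U a)) ∧ ∀ a b, K a b → Disjoint (U a) (U b) := by
  classical
  -- Coordinates in `I` have become fixed large sets, so their entries in `y` are dummies and `ι`
  -- never changes.
  have key : ∀ I : Finset ι, ∃ (ψ : ι → V → Finset X) (Q : Finset (ι → V)),
      (∀ a ∈ I, ∃ U : Finset X, s < #U ∧ ∀ v, ψ a v = U) ∧
      (∀ a ∉ I, ψ a = φ) ∧
      (∀ y ∈ Q, ∀ a b, K a b → Disjoint (ψ a (y a)) (ψ b (y b))) ∧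
      p ^ ((t + 1) ^ #I) * (Fintype.card V : ℝ) ^ Fintype.card ι ≤ #Q := by
    intro I
    induction I using Finset.induction_on with
    | empty => exact ⟨fun _ => φ, P, by simp, by simp, hPK, by simpa using hP⟩
    | insert i I hi ih =>
      obtain ⟨ψ, Q, hψI, hψ, hQK, hQ⟩ := ih
      have hpow : p ^ ((t + 1) ^ Fintype.card ι) ≤ p ^ ((t + 1) ^ #I) :=
        pow_le_pow_of_le_one hp.le (by linarith)
          (Nat.pow_le_pow_right (by omega) (card_le_univ I))
      obtain ⟨T, hT, hcard⟩ := exists_blowup_coordinate φ hφ s t Q i (p ^ ((t + 1) ^ #I))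
        (by positivity) hQ (hbad.trans (pow_le_pow_left₀ (by positivity) (by gcongr) t))
      set W := univ.biUnion fun j => φ (T j) with hW
      refine ⟨Function.update ψ i (fun _ => W),
        ({y : ι → V | ∀ j, Function.update y i (T j) ∈ Q} : Finset _), ?_, ?_, ?_, ?_⟩
      · intro a ha
        by_cases hai : a = i
        · subst hai
          exact ⟨W, hT, by simp⟩
        · rw [Function.update_of_ne hai]
          exact hψI a ((mem_insert.1 ha).resolve_left hai)
      · intro a ha
        rw [mem_insert, not_or] at ha
        rw [Function.update_of_ne ha.1]
        exact hψ a ha.2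
      · intro y hy a b hab
        simp only [mem_filter, mem_univ, true_and] at hy
        have hab' : a ≠ b := fun h => hK a (h ▸ hab)
        by_cases hai : a = i
        · subst hai
          rw [Function.update_self, Function.update_of_ne hab'.symm, hW, disjoint_biUnion_left]
          intro j _
          have h1 := hQK _ (hy j) a b hab
          rwa [Function.update_self, Function.update_of_ne hab'.symm, hψ a hi] at h1
        · by_cases hbi : b = i
          · subst hbi
            rw [Function.update_self, Function.update_of_ne hab', hW, disjoint_biUnion_right]
            intro j _
            have h1 := hQK _ (hy j) a b hab
            rwa [Function.update_self, Function.update_of_ne hab', hψ b hi] at h1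
          · rw [Function.update_of_ne hai, Function.update_of_ne hbi]
            rcases Nat.eq_zero_or_pos t with ht | ht
            · subst ht
              simp [hW] at hT
            · have h1 := hQK _ (hy ⟨0, ht⟩) a b hab
              rwa [Function.update_of_ne hai, Function.update_of_ne hbi] at h1
      · refine le_trans ?_ hcard
        gcongr
        -- One step turns density r into r^t / 2, which is at least r^(t+1) because r ≤ 1/2.
        rw [card_insert_of_notMem hi, pow_succ, pow_mul, pow_succ]
        set r := p ^ ((t + 1) ^ #I)
        have hr0 : 0 < r := by positivity
        have hr : r ≤ 1 / 2 :=
          (pow_le_of_le_one hp.le (by linarith) (by positivity)).trans hp2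
        have : 0 < r ^ t := by positivity
        nlinarith
  obtain ⟨ψ, Q, hψ, -, hQK, hQ⟩ := key univ
  have hQpos : 0 < #Q := by
    have h1 : (0 : ℝ) < Fintype.card V := by exact_mod_cast Fintype.card_pos
    have h2 : (0 : ℝ) < #Q := lt_of_lt_of_le (by positivity) hQ
    exact_mod_cast h2
  obtain ⟨y, hy⟩ := card_pos.1 hQpos
  choose U hU hψU using fun a => hψ a (mem_univ a)
  refine ⟨U, hU, fun a b hab => ?_⟩
  have := hQK y hy a b hab
  rwa [hψU, hψU] at this

/-! ### Large sets along odd chains -/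

/-- In a closed chain of odd length of large sets, some two consecutive ones are far from
disjoint. -/
theorem card_le_of_odd_closed_chain {X : Type*} [Fintype X] [DecidableEq X] (r e k : ℕ)
    (Z : ℕ → Finset X) (hr : ∀ i, r ≤ #(Z i)) (he : Fintype.card X ≤ e + 2 * r)
    (hZ : Z (2 * k + 1) = Z 0) (hd : ∀ i ≤ 2 * k, #(Z i ∩ Z (i + 1)) ≤ e) :
    r ≤ (3 * k + 1) * e := by
  have htri : ∀ A B C : Finset X, #(A \ C) ≤ #(A \ B) + #(B \ C) := by
    intro A B C
    refine (card_le_card ?_).trans (card_union_le _ _)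
    intro x
    simp only [mem_sdiff, mem_union]
    tauto
  -- `Z i ∪ Z (i + 2)` meets `Z (i + 1)` in at most 2e points, so it has at most |X| - r + 2e ≤ r +
  -- 3e elements.
  have hstep : ∀ i, i + 1 ≤ 2 * k → #(Z i \ Z (i + 2)) ≤ 3 * e := by
    intro i hi
    have h1 := hd i (by omega)
    have h2 : #(Z (i + 1) ∩ Z (i + 2)) ≤ e := hd (i + 1) hi
    have h3 : #((Z i ∪ Z (i + 2)) ∩ Z (i + 1)) ≤ 2 * e := by
      rw [union_inter_distrib_right]
      refine (card_union_le _ _).trans ?_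
      rw [inter_comm (Z (i + 2))]
      omega
    have h4 := card_union_add_card_inter (Z i ∪ Z (i + 2)) (Z (i + 1))
    have h5 := card_le_univ ((Z i ∪ Z (i + 2)) ∪ Z (i + 1))
    have h6 : #(Z i \ Z (i + 2)) + #(Z (i + 2)) = #(Z i ∪ Z (i + 2)) := card_sdiff_add_card _ _
    have h7 := hr (i + 1)
    have h8 := hr (i + 2)
    omega
  have hchain : ∀ l ≤ k, #(Z 0 \ Z (2 * l)) ≤ 3 * l * e := by
    intro l
    induction l with
    | zero => simp
    | succ l ih =>
      intro hl
      have h1 := htri (Z 0) (Z (2 * l)) (Z (2 * l + 2))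
      have h2 := ih (by omega)
      have h3 := hstep (2 * l) (by omega)
      have h4 : 3 * (l + 1) * e = 3 * l * e + 3 * e := by ring
      have h5 : 2 * (l + 1) = 2 * l + 2 := by ring
      rw [h4, h5]
      omega
  have h1 := hchain k le_rfl
  have h2 := hd (2 * k) le_rfl
  rw [hZ, inter_comm] at h2
  have h3 := card_sdiff_add_card_inter (Z 0) (Z (2 * k))
  have h4 := hr 0
  have h5 : (3 * k + 1) * e = 3 * k * e + e := by ring
  rw [h5]
  omega

/-- Sets joined by a chain of three disjointness relations are almost disjoint. -/
theorem card_inter_le_of_disjoint_chain {X : Type*} [Fintype X] [DecidableEq X] (r e : ℕ)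
    {A B C D : Finset X} (hB : r ≤ #B) (hC : r ≤ #C) (he : Fintype.card X ≤ e + 2 * r)
    (hAB : Disjoint A B) (hBC : Disjoint B C) (hCD : Disjoint C D) : #(A ∩ D) ≤ e := by
  have h1 : Disjoint (A ∩ D) (B ∪ C) := by
    rw [disjoint_union_right]
    exact ⟨hAB.mono_left inter_subset_left, (hCD.mono_right inter_subset_right).symm⟩
  have h2 := card_le_univ ((A ∩ D) ∪ (B ∪ C))
  rw [card_union_of_disjoint h1, card_union_of_disjoint hBC] at h2
  omega

/-! ### Sampling vertices and colouring by neighbourhoods -/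

/-- The number of ordered pairs of adjacent vertices whose first vertex has no neighbour among
the sample `S`. -/
noncomputable def uncoveredCount {V : Type*} [Fintype V] (G : SimpleGraph V) {q : ℕ}
    (S : Fin q → V) : ℕ := by
  classical exact #{z : V × V | G.Adj z.1 z.2 ∧ ∀ i, ¬ G.Adj (S i) z.1}

/-- The set of edges, with an orientation, from the neighbourhood of `a` to that of `b`. -/
noncomputable def bridges {V : Type*} [Fintype V] (G : SimpleGraph V) (a b : V) :
    Finset (V × V) := by
  classical exact {z : V × V | G.Adj a z.1 ∧ G.Adj z.1 z.2 ∧ G.Adj z.2 b}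

theorem mem_bridges {V : Type*} [Fintype V] {G : SimpleGraph V} {a b : V} {z : V × V} :
    z ∈ bridges G a b ↔ G.Adj a z.1 ∧ G.Adj z.1 z.2 ∧ G.Adj z.2 b := by
  simp [bridges]

theorem card_bridges_comm {V : Type*} [Fintype V] (G : SimpleGraph V) (a b : V) :
    #(bridges G a b) ≤ #(bridges G b a) := by
  refine card_le_card_of_injOn Prod.swap ?_ Prod.swap_injective.injOn
  intro z hz
  rw [mem_coe, mem_bridges] at hz ⊢
  exact ⟨hz.2.2.symm, hz.2.1.symm, hz.1.symm⟩

/-- If the sample points can be two-coloured so that there are few edges between neighbourhoods of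
points of the same colour, then `G` is close to bipartite. -/
theorem canBeMadeBipartite_of_sample_coloring {V : Type*} [Fintype V] (G : SimpleGraph V) {q : ℕ}
    (hq : 0 < q) (S : Fin q → V) (η : ℝ) (hη : 0 ≤ η) (f : Fin q → Bool)
    (hf : ∀ j k, η ≤ #(bridges G (S j) (S k)) → f j ≠ f k) :
    CanBeMadeBipartiteByRemoving G (uncoveredCount G S + q ^ 2 * η) := by
  classical
  -- Vertices with no sampled neighbour get the default index 0; their edges are charged to `U`.
  have hidx : ∀ v, ∃ j : Fin q, (∃ i, G.Adj (S i) v) → G.Adj (S j) v := by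
    intro v
    by_cases h : ∃ i, G.Adj (S i) v
    · exact ⟨h.choose, fun _ => h.choose_spec⟩
    · exact ⟨⟨0, hq⟩, fun h' => absurd h' h⟩
  choose idx hidx using hidx
  let mono : Finset (V × V) := {z : V × V | G.Adj z.1 z.2 ∧ f (idx z.1) = f (idx z.2)}
  let mk : V × V → Sym2 V := fun z => s(z.1, z.2)
  let U : Finset (V × V) := {z : V × V | G.Adj z.1 z.2 ∧ ∀ i, ¬ G.Adj (S i) z.1}
  let J : Finset (Fin q × Fin q) :=
    {z : Fin q × Fin q | (#(bridges G (S z.1) (S z.2)) : ℝ) < η}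
  let E : Finset (V × V) := J.biUnion fun z => bridges G (S z.1) (S z.2)
  refine ⟨mono.image mk, ?_, ?_, ?_⟩
  · intro e he
    simp only [coe_image, Set.mem_image, mem_coe] at he
    obtain ⟨z, hz, rfl⟩ := he
    simp only [mono, mem_filter, mem_univ, true_and] at hz
    simpa [mk] using hz.1
  · have hsub : mono.image mk ⊆ (U ∪ E).image mk := by
      intro e he
      obtain ⟨z, hz, rfl⟩ := mem_image.1 he
      simp only [mono, mem_filter, mem_univ, true_and] at hz
      by_cases h1 : ∃ i, G.Adj (S i) z.1
      · by_cases h2 : ∃ i, G.Adj (S i) z.2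
        · refine mem_image_of_mem mk (mem_union_right _ ?_)
          simp only [E, J, mem_biUnion, mem_filter, mem_univ, true_and]
          refine ⟨(idx z.1, idx z.2), ?_, ?_⟩
          · by_contra! hcon
            exact hf _ _ hcon hz.2
          · exact mem_bridges.2 ⟨hidx _ h1, hz.1, (hidx _ h2).symm⟩
        · refine mem_image.2 ⟨z.swap, mem_union_left _ ?_, Sym2.eq_swap⟩
          push Not at h2
          simp only [U, mem_filter, mem_univ, true_and]
          exact ⟨hz.1.symm, h2⟩
      · refine mem_image_of_mem mk (mem_union_left _ ?_)
        push Not at h1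
        simp only [U, mem_filter, mem_univ, true_and]
        exact ⟨hz.1, h1⟩
    have h1 : #(mono.image mk) ≤ #U + #E :=
      (card_le_card hsub).trans (card_image_le.trans (card_union_le _ _))
    have hU : #U = uncoveredCount G S := by
      simp only [U, uncoveredCount]
    have hE : (#E : ℝ) ≤ q ^ 2 * η := by
      have h2 : (#E : ℝ) ≤ ∑ z ∈ J, (#(bridges G (S z.1) (S z.2)) : ℝ) := by
        exact_mod_cast card_biUnion_le
      have h3 : ∑ z ∈ J, (#(bridges G (S z.1) (S z.2)) : ℝ) ≤ #J • η := by
        refine sum_le_card_nsmul _ _ _ fun z hz => ?_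
        simp only [J, mem_filter, mem_univ, true_and] at hz
        exact hz.le
      have h4 : (#J : ℝ) ≤ q ^ 2 := by
        have : #J ≤ q ^ 2 := (card_le_univ _).trans (by simp [sq])
        exact_mod_cast this
      rw [nsmul_eq_mul] at h3
      exact h2.trans (h3.trans (by gcongr))
    have h5 : (#(mono.image mk) : ℝ) ≤ #U + #E := by exact_mod_cast h1
    rw [← hU]
    linarith
  · have hc : ∀ {v w : V}, (G.deleteEdges (mono.image mk : Set (Sym2 V))).Adj v w →
        f (idx v) ≠ f (idx w) := by
      intro v w hvw heq
      rw [SimpleGraph.deleteEdges_adj] at hvw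
      refine hvw.2 (mem_coe.2 (mem_image.2 ⟨(v, w), ?_, rfl⟩))
      simp only [mono, mem_filter, mem_univ, true_and]
      exact ⟨hvw.1, heq⟩
    exact (SimpleGraph.Coloring.mk (fun v => f (idx v)) hc).colorable

/-- With x = d/N this is qx(1-x)^q ≤ 1. Bernoulli gives (1-x)^q (1+qx) ≤ (1-x²)^q ≤ 1. -/
theorem mul_mul_pow_sub_le {d N : ℝ} (hd : 0 ≤ d) (hdN : d ≤ N) (q : ℕ) :
    q * (d * (N - d) ^ q) ≤ N ^ (q + 1) := by
  rcases hd.eq_or_lt with h0 | hpos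
  · rw [← h0]
    simp only [zero_mul, mul_zero]
    exact pow_nonneg (hd.trans hdN) _
  have hN : 0 < N := hpos.trans_le hdN
  have h1 : 1 + q * (d / N) ≤ (1 + d / N) ^ q :=
    one_add_mul_le_pow (by have : 0 ≤ d / N := by positivity
                           linarith) q
  have hx1 : d / N ≤ 1 := (div_le_one hN).2 hdN
  have h2 : (1 - d / N) ^ q * (1 + q * (d / N)) ≤ 1 := by
    calc (1 - d / N) ^ q * (1 + q * (d / N))
        ≤ (1 - d / N) ^ q * (1 + d / N) ^ q :=
          mul_le_mul_of_nonneg_left h1 (pow_nonneg (by linarith) _)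
      _ = ((1 - d / N) * (1 + d / N)) ^ q := (mul_pow _ _ _).symm
      _ ≤ 1 := by
        refine pow_le_one₀ ?_ ?_
        · have : 0 ≤ d / N := by positivity
          nlinarith
        · nlinarith [sq_nonneg (d / N)]
  have h3 : 0 ≤ (1 - d / N) ^ q := pow_nonneg (by linarith) _
  have h4 : q * (d / N * (1 - d / N) ^ q) ≤ 1 := by nlinarith
  have h5 : N - d = N * (1 - d / N) := by field_simp
  have h6 : d = N * (d / N) := by field_simp
  calc q * (d * (N - d) ^ q) = N ^ (q + 1) * (q * (d / N * (1 - d / N) ^ q)) := by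
        rw [h5, mul_pow]
        nth_rewrite 1 [h6]
        ring
    _ ≤ N ^ (q + 1) * 1 := by gcongr
    _ = N ^ (q + 1) := mul_one _

/-- A vertex of degree d starts d ordered pairs and is missed by (N-d)^q samples, so each vertex
contributes at most N^(q+1) by `mul_mul_pow_sub_le`. -/
theorem sum_uncoveredCount_le {V : Type*} [Fintype V] (G : SimpleGraph V) (q : ℕ) :
    (q : ℝ) * ∑ S : Fin q → V, (uncoveredCount G S : ℝ) ≤ (Fintype.card V : ℝ) ^ (q + 2) := by
  classical
  set N := Fintype.card V with hN
  have h1 : ∑ S : Fin q → V, uncoveredCount G S =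
      ∑ v, G.degree v * (N - G.degree v) ^ q := by
    simp only [uncoveredCount, card_filter]
    rw [sum_comm, Fintype.sum_prod_type]
    refine sum_congr rfl fun v _ => ?_
    have h2 : ∀ w, (∑ S : Fin q → V, if G.Adj v w ∧ ∀ i, ¬ G.Adj (S i) v then 1 else 0) =
        if G.Adj v w then (N - G.degree v) ^ q else 0 := by
      intro w
      by_cases hvw : G.Adj v w
      · simp only [hvw, true_and, if_true]
        rw [← card_filter]
        have h3 : ({S : Fin q → V | ∀ i, ¬ G.Adj (S i) v} : Finset _) =
            Fintype.piFinset fun _ => (G.neighborFinset v)ᶜ := by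
          ext S
          simp [Fintype.mem_piFinset, G.adj_comm v]
        rw [h3, Fintype.card_piFinset_const, card_compl, G.card_neighborFinset_eq_degree]
      · simp [hvw]
    rw [sum_congr rfl fun w _ => h2 w, ← sum_filter, sum_const, smul_eq_mul,
      ← G.card_neighborFinset_eq_degree, G.neighborFinset_eq_filter]
  have h4 : ∑ S : Fin q → V, (uncoveredCount G S : ℝ) =
      ∑ v, (G.degree v : ℝ) * ((N : ℝ) - G.degree v) ^ q := by
    rw [← Nat.cast_sum, h1]
    push_cast
    refine sum_congr rfl fun v _ => ?_
    rw [Nat.cast_sub (G.degree_lt_card_verts v).le]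
  rw [h4, mul_sum]
  calc ∑ v, (q : ℝ) * ((G.degree v : ℝ) * ((N : ℝ) - G.degree v) ^ q)
      ≤ ∑ _v : V, (N : ℝ) ^ (q + 1) := by
        refine sum_le_sum fun v _ => mul_mul_pow_sub_le (by positivity) ?_ q
        exact_mod_cast (G.degree_lt_card_verts v).le
    _ = (N : ℝ) ^ (q + 2) := by
        rw [sum_const, card_univ, nsmul_eq_mul, ← hN]
        ring

/-- At least half of the samples of `q` vertices leave few edges uncovered. -/
theorem card_good_samples {V : Type*} [Fintype V] [Nonempty V] (G : SimpleGraph V) {q : ℕ}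
    (Good : Finset (Fin q → V))
    (hGood : ∀ S, (q : ℝ) * uncoveredCount G S ≤ 2 * (Fintype.card V : ℝ) ^ 2 → S ∈ Good) :
    (Fintype.card V : ℝ) ^ q ≤ 2 * #Good := by
  classical
  set N := Fintype.card V with hN
  have hNpos : (0 : ℝ) < N := by
    have : 0 < N := Fintype.card_pos
    exact_mod_cast this
  have h1 : #Goodᶜ • (2 * (N : ℝ) ^ 2) ≤ ∑ S ∈ Goodᶜ, (q : ℝ) * uncoveredCount G S := by
    refine card_nsmul_le_sum _ _ _ fun S hS => ?_
    by_contra! hlt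
    exact mem_compl.1 hS (hGood S hlt.le)
  have h2 : ∑ S ∈ Goodᶜ, (q : ℝ) * uncoveredCount G S ≤
      ∑ S : Fin q → V, (q : ℝ) * uncoveredCount G S :=
    sum_le_sum_of_subset_of_nonneg (subset_univ _) fun _ _ _ => by positivity
  have h3 := sum_uncoveredCount_le G q
  rw [mul_sum] at h3
  have h4 : (#Good : ℝ) + #Goodᶜ = (N : ℝ) ^ q := by
    have : #Good + #Goodᶜ = N ^ q := by
      rw [card_add_card_compl]
      simp [hN]
    exact_mod_cast this
  rw [nsmul_eq_mul] at h1
  have h5 : (#Goodᶜ : ℝ) * 2 * (N : ℝ) ^ 2 ≤ (N : ℝ) ^ q * (N : ℝ) ^ 2 := by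
    rw [← pow_add]
    linarith
  have h6 := le_of_mul_le_mul_right h5 (by positivity)
  linarith

/-- A graph far from bipartite has a pattern of length at most `q` along an odd closed walk
that many samples contain with many bridges. -/
theorem exists_dense_odd_pattern {V : Type*} [Fintype V] [Nonempty V] (G : SimpleGraph V) {q : ℕ}
    (hq : 0 < q)
    (hG : ¬ CanBeMadeBipartiteByRemoving G (3 / q * (Fintype.card V : ℝ) ^ 2)) :
    ∃ (m : ℕ) (w : ℕ → Fin q) (Q : Finset (Fin q → V)), m ≤ q ∧ Odd m ∧ w m = w 0 ∧
      (∀ S ∈ Q, ∀ i < m,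
        (Fintype.card V : ℝ) ^ 2 / q ^ 3 ≤ #(bridges G (S (w i)) (S (w (i + 1))))) ∧
      (Fintype.card V : ℝ) ^ q ≤ 2 ^ (q ^ 2 + 1) * #Q := by
  classical
  set N := Fintype.card V with hN
  set η : ℝ := (N : ℝ) ^ 2 / q ^ 3 with hη
  have hq' : (0 : ℝ) < q := by exact_mod_cast hq
  let Good : Finset (Fin q → V) := {S | (q : ℝ) * uncoveredCount G S ≤ 2 * (N : ℝ) ^ 2}
  let rel : (Fin q → V) → (Fin q × Fin q → Bool) :=
    fun S z => decide (η ≤ #(bridges G (S z.1) (S z.2)))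
  have hGood := card_good_samples G Good (fun S hS => by simpa [Good] using hS)
  have hNpos : (0 : ℝ) < N := by
    have : 0 < N := Fintype.card_pos
    exact_mod_cast this
  -- There are 2^(q²) possible relations and at least N^q / 2 good samples. Fixing the relation
  -- makes one walk work for all of `Q`.
  obtain ⟨ρ, -, hρ⟩ := exists_le_card_fiber_of_nsmul_le_card_of_maps_to
    (s := Good) (t := (univ : Finset (Fin q × Fin q → Bool))) (f := rel)
    (b := (N : ℝ) ^ q / 2 ^ (q ^ 2 + 1)) (fun _ _ => mem_univ _) univ_nonempty (by
      have h1 : #(univ : Finset (Fin q × Fin q → Bool)) = 2 ^ (q ^ 2) := by simp [sq]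
      rw [h1, nsmul_eq_mul]
      push_cast
      rw [pow_succ (2 : ℝ)]
      have h2 : (2 : ℝ) ^ (q ^ 2) ≠ 0 := by positivity
      have h3 : (2 : ℝ) ^ (q ^ 2) * ((N : ℝ) ^ q / (2 ^ (q ^ 2) * 2)) = (N : ℝ) ^ q / 2 := by
        field_simp
      rw [h3]
      linarith)
  set Q : Finset (Fin q → V) := Good.filter fun S => rel S = ρ with hQ
  have hQpos : 0 < #Q := by
    have : (0 : ℝ) < #Q := lt_of_lt_of_le (by positivity) hρ
    exact_mod_cast this
  obtain ⟨S₀, hS₀⟩ := card_pos.1 hQpos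
  rw [hQ, mem_filter] at hS₀
  have hrel : ∀ S, rel S = ρ → ∀ j k, ρ (j, k) = true ↔ η ≤ #(bridges G (S j) (S k)) := by
    intro S hS j k
    rw [← hS]
    simp [rel]
  rcases two_coloring_or_odd_closed_walk (fun j k => ρ (j, k) = true) (by
    intro j k h
    rw [hrel S₀ hS₀.2] at h ⊢
    refine h.trans ?_
    exact_mod_cast card_bridges_comm G _ _) with ⟨f, hf⟩ | ⟨m, w, hm, hodd, hw, hR⟩
  · exfalso
    apply hG
    obtain ⟨D, hD, hDcard, hDbip⟩ := canBeMadeBipartite_of_sample_coloring G hq S₀ η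
      (by positivity) f (fun j k h => hf j k ((hrel S₀ hS₀.2 j k).2 h))
    refine ⟨D, hD, hDcard.trans ?_, hDbip⟩
    have h1 : (q : ℝ) * uncoveredCount G S₀ ≤ 2 * (N : ℝ) ^ 2 := by
      simpa [Good] using hS₀.1
    have h2 : (q : ℝ) ^ 2 * η = (N : ℝ) ^ 2 / q := by
      rw [hη]
      field_simp
    have h3 : (uncoveredCount G S₀ : ℝ) ≤ 2 * (N : ℝ) ^ 2 / q := by
      rw [le_div_iff₀ hq']
      linarith
    rw [h2]
    calc (uncoveredCount G S₀ : ℝ) + (N : ℝ) ^ 2 / q ≤ 2 * (N : ℝ) ^ 2 / q + (N : ℝ) ^ 2 / q := by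
          linarith
      _ = 3 / q * (N : ℝ) ^ 2 := by ring
  · refine ⟨m, w, Q, hm, hodd, hw, ?_, ?_⟩
    · intro S hS i hi
      exact (hrel S (mem_filter.1 hS).2 _ _).1 (hR i hi)
    · rw [div_le_iff₀ (by positivity)] at hρ
      linarith

/-! ### Subdivided walks and the contradiction -/

/-- The pattern of an odd closed walk `w` of length `m`, each step of which is subdivided twice. -/
def subdividedWalk {q : ℕ} (w : ℕ → Fin q) (m : ℕ) (a b : Fin q ⊕ Fin q × Bool) : Prop :=
  ∃ i : Fin q, i < m ∧
    ((a = Sum.inl (w i) ∧ b = Sum.inr (i, true)) ∨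
      (a = Sum.inr (i, true) ∧ b = Sum.inr (i, false)) ∨
      (a = Sum.inr (i, false) ∧ b = Sum.inl (w (i + 1))))

theorem not_subdividedWalk_self {q : ℕ} (w : ℕ → Fin q) (m : ℕ) (a : Fin q ⊕ Fin q × Bool) :
    ¬ subdividedWalk w m a a := by
  rintro ⟨i, -, ⟨rfl, h⟩ | ⟨rfl, h⟩ | ⟨rfl, h⟩⟩ <;> simp at h

/-- A bridge is chosen independently for each step. Indices `i ≥ m` are unconstrained and have N² ≥
η choices, so the factor is η^q whatever `m` is. -/
theorem exists_many_subdividedWalk_homs {V : Type*} [Fintype V] (G : SimpleGraph V) {q : ℕ}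
    (m : ℕ) (w : ℕ → Fin q) (Q : Finset (Fin q → V)) (η : ℝ) (hη : 0 ≤ η)
    (hηV : η ≤ (Fintype.card V : ℝ) ^ 2)
    (hQ : ∀ S ∈ Q, ∀ i < m, η ≤ #(bridges G (S (w i)) (S (w (i + 1))))) :
    ∃ P : Finset (Fin q ⊕ Fin q × Bool → V),
      (∀ y ∈ P, ∀ a b, subdividedWalk w m a b → G.Adj (y a) (y b)) ∧ #Q * η ^ q ≤ #P := by
  classical
  let C : (Fin q → V) → Fin q → Finset (V × V) := fun S i =>
    if (i : ℕ) < m then bridges G (S (w i)) (S (w (i + 1))) else univ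
  let join : (Σ _ : Fin q → V, Fin q → V × V) → (Fin q ⊕ Fin q × Bool → V) := fun z =>
    Sum.elim z.1 fun p => if p.2 then (z.2 p.1).1 else (z.2 p.1).2
  have hjoin : Function.Injective join := by
    rintro ⟨S, g⟩ ⟨S', g'⟩ h
    have h1 : S = S' := by
      ext j
      exact congrFun h (Sum.inl j)
    have h2 : g = g' := by
      ext i
      · simpa [join] using congrFun h (Sum.inr (i, true))
      · simpa [join] using congrFun h (Sum.inr (i, false))
    rw [h1, h2]
  let R : Finset (Σ _ : Fin q → V, Fin q → V × V) := Q.sigma fun S => Fintype.piFinset (C S)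
  refine ⟨R.image join, ?_, ?_⟩
  · intro y hy a b hab
    obtain ⟨⟨S, g⟩, hz, rfl⟩ := mem_image.1 hy
    obtain ⟨-, hg⟩ := mem_sigma.1 hz
    obtain ⟨i, hi, h⟩ := hab
    have hgi := Fintype.mem_piFinset.1 hg i
    simp only [C, hi, if_true] at hgi
    obtain ⟨h1, h2, h3⟩ := mem_bridges.1 hgi
    rcases h with ⟨rfl, rfl⟩ | ⟨rfl, rfl⟩ | ⟨rfl, rfl⟩
    · simpa [join] using h1
    · simpa [join] using h2
    · simpa [join] using h3
  · rw [card_image_of_injective _ hjoin, card_sigma]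
    push_cast
    rw [← nsmul_eq_mul]
    refine card_nsmul_le_sum _ _ _ fun S hS => ?_
    rw [Fintype.card_piFinset]
    push_cast
    calc η ^ q = ∏ _i : Fin q, η := by simp
      _ ≤ ∏ i, (#(C S i) : ℝ) := by
        refine prod_le_prod (fun _ _ => hη) fun i _ => ?_
        by_cases hi : (i : ℕ) < m
        · simp only [C, hi, if_true]
          exact hQ S hS i hi
        · simp only [C, hi, if_false, card_univ, Fintype.card_prod]
          push_cast
          rwa [← sq]

/-- A graph of pairwise disjoint sets is close to bipartite, under numerical conditions. -/
theorem canBeMadeBipartite_of_parameters {X V : Type*} [Fintype X] [Fintype V] [Nonempty V]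
    (φ : V → Finset X) (hφ : Function.Injective φ) (G : SimpleGraph V)
    (hG : ∀ v w, G.Adj v w → Disjoint (φ v) (φ w)) {q : ℕ} (hq : 0 < q) (s t e : ℕ)
    (hbad : 2 * (2 ^ Fintype.card X * (2 ^ s) ^ t : ℝ) ≤
      ((1 / (2 ^ (q ^ 2 + 1) * (q : ℝ) ^ (3 * q))) ^ ((t + 1) ^ (3 * q)) * Fintype.card V) ^ t)
    (he : Fintype.card X ≤ e + 2 * (s + 1)) (hse : 2 * q * e < s + 1) :
    CanBeMadeBipartiteByRemoving G (3 / q * (Fintype.card V : ℝ) ^ 2) := by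
  classical
  by_contra hfar
  obtain ⟨m, w, Q, hm, ⟨k, hk⟩, hw, hQ, hQcard⟩ := exists_dense_odd_pattern G hq hfar
  set N := Fintype.card V with hN
  have hq1 : (1 : ℝ) ≤ q := by exact_mod_cast hq
  have hq0 : (0 : ℝ) < q := by linarith
  obtain ⟨P, hP, hPcard⟩ := exists_many_subdividedWalk_homs G m w Q ((N : ℝ) ^ 2 / q ^ 3)
    (by positivity) (div_le_self (by positivity) (one_le_pow₀ hq1)) hQ
  have hι : Fintype.card (Fin q ⊕ Fin q × Bool) = 3 * q := by
    simp only [Fintype.card_sum, Fintype.card_prod, Fintype.card_fin, Fintype.card_bool]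
    ring
  -- The power of 2 is the loss from fixing the relation; q^(3q) comes from the q factors η = N²/q³.
  set p : ℝ := 1 / (2 ^ (q ^ 2 + 1) * (q : ℝ) ^ (3 * q)) with hp
  have hp2 : p ≤ 1 / 2 := by
    refine one_div_le_one_div_of_le (by norm_num) ?_
    have h1 : (2 : ℝ) ≤ 2 ^ (q ^ 2 + 1) := by
      rw [pow_succ]
      have : (1 : ℝ) ≤ 2 ^ (q ^ 2) := one_le_pow₀ (by norm_num)
      linarith
    have h2 : (1 : ℝ) ≤ (q : ℝ) ^ (3 * q) := one_le_pow₀ hq1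
    nlinarith
  have hPN : p * (N : ℝ) ^ Fintype.card (Fin q ⊕ Fin q × Bool) ≤ #P := by
    refine le_trans ?_ hPcard
    rw [hι, hp, div_pow, ← pow_mul, ← pow_mul]
    have h1 : (N : ℝ) ^ (3 * q) = (N : ℝ) ^ q * (N : ℝ) ^ (2 * q) := by
      rw [← pow_add]
      ring_nf
    rw [h1, one_div_mul_eq_div, ← mul_div_assoc, div_le_div_iff₀ (by positivity) (by positivity)]
    calc (N : ℝ) ^ q * (N : ℝ) ^ (2 * q) * (q : ℝ) ^ (3 * q)
        ≤ (2 ^ (q ^ 2 + 1) * #Q) * (N : ℝ) ^ (2 * q) * (q : ℝ) ^ (3 * q) := by gcongr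
      _ = #Q * (N : ℝ) ^ (2 * q) * (2 ^ (q ^ 2 + 1) * (q : ℝ) ^ (3 * q)) := by ring
  obtain ⟨U, hUs, hU⟩ := exists_large_disjoint_pattern φ hφ s t (subdividedWalk w m)
    (not_subdividedWalk_self w m) p (by positivity) hp2 (by rw [hι]; exact hbad) P
    (fun y hy a b hab => hG _ _ (hP y hy a b hab)) hPN
  have hr := card_le_of_odd_closed_chain (s + 1) e k (fun i => U (Sum.inl (w i)))
    (fun i => hUs _) he (by rw [← hk, hw]) (fun i hi => by
      have him : i < m := by omega
      have hiq : i < q := by omega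
      refine card_inter_le_of_disjoint_chain (s + 1) e (hUs (Sum.inr (⟨i, hiq⟩, true)))
        (hUs (Sum.inr (⟨i, hiq⟩, false))) he (hU _ _ ?_) (hU _ _ ?_) (hU _ _ ?_)
      · exact ⟨⟨i, hiq⟩, him, Or.inl ⟨rfl, rfl⟩⟩
      · exact ⟨⟨i, hiq⟩, him, Or.inr (Or.inl ⟨rfl, rfl⟩)⟩
      · exact ⟨⟨i, hiq⟩, him, Or.inr (Or.inr ⟨rfl, rfl⟩)⟩)
  -- Here 2k + 1 = m ≤ q.
  have h1 : (3 * k + 1) * e ≤ 2 * q * e := Nat.mul_le_mul_right e (by omega)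
  omega

/-! ### Choice of parameters -/

theorem parameter_bound (d q n : ℕ) (hq : 65 ≤ q) (hd : d ≤ q) (hn : q ^ (7 * q) ≤ n) :
    64 * q * (5 * q ^ 2 * (64 * q + 1) ^ (3 * q) + d) + 1 ≤ n := by
  refine le_trans ?_ hn
  have h1 : (64 * q + 1) ^ (3 * q) ≤ q ^ (6 * q) := by
    calc (64 * q + 1) ^ (3 * q) ≤ (q ^ 2) ^ (3 * q) := Nat.pow_le_pow_left (by nlinarith) _
      _ = q ^ (6 * q) := by rw [← pow_mul]; ring_nf
  set M := q ^ (6 * q) with hM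
  have hM1 : 1 ≤ M := Nat.one_le_pow _ _ (by omega)
  have h2 : M * q ^ 5 ≤ q ^ (7 * q) := by
    rw [hM, ← pow_add]
    exact Nat.pow_le_pow_right (by omega) (by omega)
  refine le_trans ?_ h2
  have hq2 : 448 ≤ q ^ 2 := by nlinarith
  have hdq : d ≤ q ^ 2 * M := by nlinarith
  calc 64 * q * (5 * q ^ 2 * (64 * q + 1) ^ (3 * q) + d) + 1
      ≤ 64 * q * (5 * q ^ 2 * M + q ^ 2 * M) + 64 * q ^ 3 * M := by
        have h3 : 1 ≤ 64 * q ^ 3 * M := by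
          have : 0 < q ^ 3 := by positivity
          nlinarith
        gcongr
    _ = 448 * (q ^ 3 * M) := by ring
    _ ≤ q ^ 2 * (q ^ 3 * M) := by gcongr
    _ = M * q ^ 5 := by ring

/-- Comparing exponents of 2: the deficit n/(16q) in `s`, taken t = 64q times, saves 4n. This pays
for the n from choosing the union, and `parameter_bound` absorbs the losses from p and c. -/
theorem tuple_bound (c : ℝ) (d q n s : ℕ) (N : ℝ) (hq : 65 ≤ q) (hd : d ≤ q)
    (hc : (1 / 2 : ℝ) ^ d ≤ c) (hn : q ^ (7 * q) ≤ n)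
    (hN : c * (2 : ℝ) ^ ((n : ℝ) / 2) ≤ N) (hs : (s : ℝ) ≤ n / 2 - n / (16 * q)) :
    2 * (2 ^ n * (2 ^ s) ^ (64 * q) : ℝ) ≤
      ((1 / (2 ^ (q ^ 2 + 1) * (q : ℝ) ^ (3 * q))) ^ ((64 * q + 1) ^ (3 * q)) * N) ^ (64 * q) := by
  have hqpos : (0 : ℝ) < q := by
    have : 0 < q := by omega
    exact_mod_cast this
  have hpar := parameter_bound d q n hq hd hn
  set E := (64 * q + 1) ^ (3 * q) with hE
  have hp : (1 / 2 : ℝ) ^ (5 * q ^ 2) ≤ 1 / (2 ^ (q ^ 2 + 1) * (q : ℝ) ^ (3 * q)) := by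
    rw [one_div_pow]
    refine one_div_le_one_div_of_le (by positivity) ?_
    have h1 : (q : ℝ) ≤ 2 ^ q := by exact_mod_cast (Nat.lt_two_pow_self).le
    calc (2 : ℝ) ^ (q ^ 2 + 1) * (q : ℝ) ^ (3 * q) ≤ 2 ^ (q ^ 2 + 1) * (2 ^ q) ^ (3 * q) := by
          gcongr
      _ = 2 ^ (q ^ 2 + 1 + q * (3 * q)) := by rw [← pow_mul, ← pow_add]
      _ ≤ 2 ^ (5 * q ^ 2) := pow_le_pow_right₀ (by norm_num) (by nlinarith)
  have hbase : (2 : ℝ) ^ ((n : ℝ) / 2 - (5 * q ^ 2 * E + d)) ≤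
      (1 / (2 ^ (q ^ 2 + 1) * (q : ℝ) ^ (3 * q))) ^ E * N := by
    have h1 : (2 : ℝ) ^ ((n : ℝ) / 2 - (5 * q ^ 2 * E + d)) =
        (1 / 2 : ℝ) ^ (5 * q ^ 2 * E) * ((1 / 2 : ℝ) ^ d * (2 : ℝ) ^ ((n : ℝ) / 2)) := by
      rw [Real.rpow_sub (by norm_num)]
      have h2 : (2 : ℝ) ^ ((5 * q ^ 2 * E + d : ℝ)) = 2 ^ (5 * q ^ 2 * E) * 2 ^ d := by
        rw [← pow_add, ← Real.rpow_natCast (2 : ℝ)]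
        push_cast
        rfl
      rw [h2, one_div_pow, one_div_pow]
      field_simp
    rw [h1, pow_mul]
    have h3 : (1 / 2 : ℝ) ^ d * (2 : ℝ) ^ ((n : ℝ) / 2) ≤ N := by
      refine le_trans ?_ hN
      gcongr
    gcongr
  refine le_trans ?_ (pow_le_pow_left₀ (by positivity) hbase _)
  have hlhs : 2 * (2 ^ n * (2 ^ s) ^ (64 * q) : ℝ) = (2 : ℝ) ^ ((1 + n + s * (64 * q) : ℝ)) := by
    rw [← pow_mul, ← pow_add, ← pow_succ', ← Real.rpow_natCast]
    push_cast
    ring_nf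
  rw [hlhs, ← Real.rpow_natCast, ← Real.rpow_mul (by norm_num)]
  refine Real.rpow_le_rpow_of_exponent_le (by norm_num) ?_
  push_cast
  have hpar' : 64 * (q : ℝ) * (5 * q ^ 2 * E + d) + 1 ≤ n := by exact_mod_cast hpar
  have hs' : (s : ℝ) * (64 * q) ≤ (n / 2 - n / (16 * q)) * (64 * q) := by gcongr
  have h4 : ((n : ℝ) / 2 - n / (16 * q)) * (64 * q) = 32 * q * n - 4 * n := by
    field_simp
    ring
  rw [h4] at hs'
  have h5 : (0 : ℝ) ≤ n := by positivity
  linarith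

theorem canBeMadeBipartite_of_pow_le (c : ℝ) (hc : 0 < c) :
    ∃ q₀ : ℕ, ∀ (q : ℕ), q₀ ≤ q → ∀ {X V : Type*} [Fintype X] [Fintype V]
      (φ : V → Finset X) (_ : Function.Injective φ) (G : SimpleGraph V)
      (_ : ∀ v w, G.Adj v w → Disjoint (φ v) (φ w)),
      q ^ (7 * q) ≤ Fintype.card X →
      c * (2 : ℝ) ^ ((Fintype.card X : ℝ) / 2) ≤ Fintype.card V →
      CanBeMadeBipartiteByRemoving G (3 / q * (Fintype.card V : ℝ) ^ 2) := by
  obtain ⟨d, hd⟩ := exists_pow_lt_of_lt_one hc (by norm_num : (1 / 2 : ℝ) < 1)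
  -- 65 ensures 64q + 1 ≤ q² in `parameter_bound`; `d` satisfies 2^(-d) < c.
  refine ⟨max 65 d, fun q hq X V _ _ φ hφ G hG hn hV => ?_⟩
  have hq65 : 65 ≤ q := (le_max_left _ _).trans hq
  have hdq : d ≤ q := (le_max_right _ _).trans hq
  set n := Fintype.card X with hnX
  have hq65' : (65 : ℝ) ≤ q := by exact_mod_cast hq65
  have hn1 : (1 : ℝ) ≤ n := by
    have : 1 ≤ n := (Nat.one_le_pow _ _ (by omega)).trans hn
    exact_mod_cast this
  have hne : Nonempty V := by
    have h1 : (0 : ℝ) < Fintype.card V := lt_of_lt_of_le (by positivity) hV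
    exact Fintype.card_pos_iff.1 (by exact_mod_cast h1)
  have hdiv : (n : ℝ) / (16 * q) ≤ n / 16 := by
    gcongr
    linarith
  have hnonneg : (0 : ℝ) ≤ n / 2 - n / (16 * q) := by linarith
  set s := ⌊(n : ℝ) / 2 - n / (16 * q)⌋₊ with hs
  have hs1 : (s : ℝ) ≤ n / 2 - n / (16 * q) := Nat.floor_le hnonneg
  have hs2 : (n : ℝ) / 2 - n / (16 * q) < s + 1 := Nat.lt_floor_add_one _
  refine canBeMadeBipartite_of_parameters φ hφ G hG (by omega) s (64 * q) (n - 2 * (s + 1))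
    (tuple_bound c d q n s _ hq65 hdq hd.le hn hV hs1) (by omega) ?_
  rcases le_total n (2 * (s + 1)) with h | h
  · rw [Nat.sub_eq_zero_of_le h]
    omega
  · have h1 : ((2 * q * (n - 2 * (s + 1)) : ℕ) : ℝ) < ((s + 1 : ℕ) : ℝ) := by
      push_cast [Nat.cast_sub h]
      have h2 : (n : ℝ) - 2 * (s + 1) ≤ n / (8 * q) := by
        have : (n : ℝ) / (8 * q) = 2 * (n / (16 * q)) := by
          field_simp
          norm_num
        linarith
      have h3 : 2 * (q : ℝ) * ((n : ℝ) - 2 * (s + 1)) ≤ 2 * q * (n / (8 * q)) := by gcongr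
      have h4 : 2 * (q : ℝ) * (n / (8 * q)) = n / 4 := by
        field_simp
        norm_num
      linarith
    exact_mod_cast h1

/-! ### Small n, logarithmic estimates and conclusion -/

theorem canBeMadeBipartite_of_half_sq_le {V : Type*} [Fintype V] (G : SimpleGraph V) (t : ℝ)
    (ht : (Fintype.card V : ℝ) ^ 2 / 2 ≤ t) : CanBeMadeBipartiteByRemoving G t := by
  classical
  refine ⟨G.edgeFinset, by simp, ?_, ?_⟩
  · refine le_trans ?_ ht
    have h1 := G.card_edgeFinset_le_card_choose_two
    have h2 : (#G.edgeFinset : ℝ) ≤ ((Fintype.card V).choose 2 : ℕ) := by exact_mod_cast h1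
    rw [Nat.cast_choose_two] at h2
    have h3 : (0 : ℝ) ≤ Fintype.card V := by positivity
    linarith [sq (Fintype.card V : ℝ)]
  · have h1 : G.deleteEdges (G.edgeFinset : Set (Sym2 V)) = ⊥ := by
      ext v w
      simp
    rw [h1]
    exact (SimpleGraph.Coloring.mk (fun _ => (0 : Fin 2)) (by simp)).colorable

open Filter Asymptotics in
theorem eventually_log_bounds (M : ℝ) :
    ∃ n₀ : ℕ, ∀ n : ℕ, n₀ ≤ n → 2 ≤ Real.logb 2 (Real.logb 2 n) ∧
      M * Real.logb 2 (Real.logb 2 n) ≤ Real.logb 2 n := by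
  have hL : Tendsto (fun n : ℕ => Real.logb 2 (n : ℝ)) atTop atTop :=
    (Real.tendsto_logb_atTop (by norm_num)).comp tendsto_natCast_atTop_atTop
  have hl := (Real.tendsto_logb_atTop (b := 2) (by norm_num)).comp hL
  have hlog : ∀ᶠ x : ℝ in atTop, M * Real.logb 2 x ≤ x := by
    have h1 : (fun x : ℝ => M * Real.logb 2 x) =o[atTop] (id : ℝ → ℝ) := by
      have h2 : (fun x : ℝ => M * Real.logb 2 x) = fun x => M / Real.log 2 * Real.log x := by
        ext x
        rw [Real.logb]
        ring
      rw [h2]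
      exact Real.isLittleO_log_id_atTop.const_mul_left _
    filter_upwards [h1.bound one_pos, eventually_ge_atTop 0] with x hx hx0
    rw [one_mul, id, Real.norm_of_nonneg hx0] at hx
    exact (le_abs_self _).trans hx
  have h := (hl.eventually_ge_atTop 2).and (hL.eventually hlog)
  obtain ⟨n₀, hn₀⟩ := eventually_atTop.1 h
  exact ⟨n₀, hn₀⟩

/-- At n = 4 the iterated logarithm is 1 and the value is exactly 1/2 for every b. From n = 5 on it
is bounded away from 1, so a large exponent beats the finitely many values of log n. -/
theorem exists_exponent_small (n₀ : ℕ) :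
    ∃ b₁ : ℝ, ∀ b, b₁ ≤ b → ∀ n : ℕ, 4 ≤ n → n < n₀ →
      1 / 2 ≤ Real.logb 2 (Real.logb 2 n) ^ b / Real.logb 2 n := by
  have h4 : Real.logb 2 4 = 2 := by
    rw [show (4 : ℝ) = 2 ^ (2 : ℝ) by norm_num, Real.logb_rpow (by norm_num) (by norm_num)]
  have h5 : Real.logb 2 4 < Real.logb 2 5 :=
    Real.logb_lt_logb (by norm_num) (by norm_num) (by norm_num)
  have hl5 : 1 < Real.logb 2 (Real.logb 2 5) := by
    rw [Real.lt_logb_iff_rpow_lt (by norm_num) (by linarith), Real.rpow_one]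
    linarith
  obtain ⟨k, hk⟩ := pow_unbounded_of_one_lt (Real.logb 2 n₀) hl5
  refine ⟨k, fun b hb n hn hn₀ => ?_⟩
  rcases hn.eq_or_lt with rfl | hn5
  · rw [Nat.cast_ofNat, h4, Real.logb_self_eq_one (by norm_num), Real.one_rpow]
  · have hn5' : (5 : ℝ) ≤ n := by exact_mod_cast hn5
    have hL5 : Real.logb 2 5 ≤ Real.logb 2 n :=
      Real.logb_le_logb_of_le (by norm_num) (by norm_num) hn5'
    have hL5pos : 0 < Real.logb 2 5 := Real.logb_pos (by norm_num) (by norm_num)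
    have hLpos : 0 < Real.logb 2 n := hL5pos.trans_le hL5
    have hl : Real.logb 2 (Real.logb 2 5) ≤ Real.logb 2 (Real.logb 2 n) :=
      Real.logb_le_logb_of_le (by norm_num) hL5pos hL5
    have h1 : Real.logb 2 n ≤ Real.logb 2 (Real.logb 2 n) ^ b := by
      calc Real.logb 2 n ≤ Real.logb 2 n₀ :=
            Real.logb_le_logb_of_le (by norm_num) (by linarith) (by exact_mod_cast hn₀.le)
        _ ≤ Real.logb 2 (Real.logb 2 5) ^ k := hk.le
        _ ≤ Real.logb 2 (Real.logb 2 n) ^ k := by gcongr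
        _ = Real.logb 2 (Real.logb 2 n) ^ (k : ℝ) := (Real.rpow_natCast _ _).symm
        _ ≤ Real.logb 2 (Real.logb 2 n) ^ b :=
            Real.rpow_le_rpow_of_exponent_le (by linarith) hb
    have h2 : 1 ≤ Real.logb 2 (Real.logb 2 n) ^ b / Real.logb 2 n := (one_le_div hLpos).2 h1
    linarith

theorem exists_sample_size (q₀ n : ℕ) (b : ℝ) (hb : 7 ≤ b)
    (hl : 2 ≤ Real.logb 2 (Real.logb 2 n))
    (hL : 7 * (q₀ + 1) * Real.logb 2 (Real.logb 2 n) ≤ Real.logb 2 n) :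
    ∃ q : ℕ, q₀ ≤ q ∧ q ^ (7 * q) ≤ n ∧
      3 / (q : ℝ) ≤ Real.logb 2 (Real.logb 2 n) ^ b / Real.logb 2 n := by
  set L := Real.logb 2 n with hLdef
  set l := Real.logb 2 L with hldef
  have hq₀ : (0 : ℝ) ≤ q₀ := by positivity
  have hLpos : 0 < L := by nlinarith
  have hnpos : (0 : ℝ) < n := by
    rcases Nat.eq_zero_or_pos n with h | h
    · rw [hLdef, h] at hLpos
      simp at hLpos
    · exact_mod_cast h
  -- Then 7q log q ≤ 7ql ≤ L, which is q^(7q) ≤ n; rounding down costs at most a factor 2.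
  set x := L / (7 * l) with hx
  have hxq : (q₀ : ℝ) + 1 ≤ x := by
    rw [hx, le_div_iff₀ (by positivity)]
    linarith
  set q := ⌊x⌋₊ with hq
  have hqx : (q : ℝ) ≤ x := Nat.floor_le (by linarith)
  have hxq' : x < q + 1 := Nat.lt_floor_add_one x
  have hq1 : 1 ≤ q := Nat.le_floor (by push_cast; linarith)
  have hq1' : (1 : ℝ) ≤ q := by exact_mod_cast hq1
  refine ⟨q, Nat.le_floor (by linarith), ?_, ?_⟩
  · have h1 : (q : ℝ) * (7 * l) ≤ L := (le_div_iff₀ (by positivity)).1 hqx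
    have h2 : (q : ℝ) ≤ L := by nlinarith
    have h3 : Real.logb 2 q ≤ l :=
      Real.logb_le_logb_of_le (by norm_num) (by linarith) h2
    have h4 : ((q : ℝ) ^ (7 * q)) ≤ n := by
      rw [← Real.logb_le_logb (b := 2) (by norm_num) (by positivity) hnpos, Real.logb_pow]
      push_cast
      nlinarith
    exact_mod_cast h4
  · rw [div_le_div_iff₀ (by linarith) hLpos]
    have h1 : L ≤ 14 * l * q := by
      have h2 : x ≤ 2 * q := by linarith
      rw [hx, div_le_iff₀ (by positivity)] at h2
      linarith
    -- 42 = 3 · 14, and l ≥ 2 gives l^6 ≥ 64.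
    have h2 : 42 * l ≤ l ^ b := by
      have h3 : l ^ (7 : ℕ) ≤ l ^ b := by
        rw [← Real.rpow_natCast]
        exact Real.rpow_le_rpow_of_exponent_le (by linarith) (by exact_mod_cast hb)
      have h4 : (2 : ℝ) ^ 6 ≤ l ^ 6 := by gcongr
      have h5 : l ^ (7 : ℕ) = l ^ 6 * l := by ring
      nlinarith
    nlinarith

theorem mainTheorem5 (c : ℝ) (hc : 0 < c) :
    ∃ b : ℝ, 0 < b ∧
      ∀ (n : ℕ) (X : Type*) [Fintype X], 4 ≤ n → Fintype.card X = n →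
        ∀ A : Finset (Finset X), c * (2 : ℝ) ^ ((n : ℝ) / 2) ≤ (A.card : ℝ) →
          CanBeMadeBipartiteByRemoving
            ((kneserGraph X).induce (A : Set (Finset X)))
            ((Real.logb 2 (Real.logb 2 (n : ℝ))) ^ b / Real.logb 2 (n : ℝ)
              * (A.card : ℝ) ^ 2) := by
  obtain ⟨q₀, hq₀⟩ := canBeMadeBipartite_of_pow_le c hc
  obtain ⟨n₀, hn₀⟩ := eventually_log_bounds (7 * (q₀ + 1))
  obtain ⟨b₁, hb₁⟩ := exists_exponent_small n₀
  refine ⟨max 7 b₁, lt_of_lt_of_le (by norm_num) (le_max_left _ _), ?_⟩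
  intro n X _ hn hX A hA
  have hcard : Fintype.card (A : Set (Finset X)) = #A := by simp
  rcases lt_or_ge n n₀ with hlt | hge
  · have h1 := hb₁ _ (le_max_right 7 b₁) n hn hlt
    refine canBeMadeBipartite_of_half_sq_le _ _ ?_
    rw [hcard]
    have h2 : (0 : ℝ) ≤ (#A : ℝ) ^ 2 := by positivity
    nlinarith
  · obtain ⟨hl, hL⟩ := hn₀ n hge
    obtain ⟨q, hq, hqn, hqb⟩ := exists_sample_size q₀ n _ (le_max_left 7 b₁) hl hL
    obtain ⟨D, hD, hDcard, hDbip⟩ := hq₀ q hq (fun v : (A : Set (Finset X)) => (v : Finset X))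
      Subtype.val_injective ((kneserGraph X).induce (A : Set (Finset X)))
      (fun v w h => h.2) (hX ▸ hqn) (by rw [hcard, hX]; exact hA)
    refine ⟨D, hD, hDcard.trans ?_, hDbip⟩
    rw [hcard]
    gcongr
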